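/- Let $\mathcal H=\{(x,v)\in\mathbb R^2: v\ge 0\}$, and let $d_H$ be the Riemannian distance on $\mathcal H$ generated by the Heston metric $ds^2=v^{-1}(dx^2+dv^2)$: $d_H(p,q)$ is the infimum of the lengths $\int_0^1\sqrt{(\dot x^2+\dot v^2)/v}\,dt$ of the curves $(x,v)$ from $p$ to $q$ that are continuous on $[0,1]$, and on $(0,1)$ are continuously differentiable with $v>0$ (the endpoints may lie on the line $v=0$). For $C\neq 0$ and $0\le v\le C^{-2}$ put $$\overline F(v,C)=\frac{\arcsin(C\sqrt v)}{C^2}-\frac{\sqrt v\sqrt{1-C^2v}}{C},\qquad F(v_0,v_1,C)=\overline F(v_1,C)-\overline F(v_0,C),\qquad F(v_0,v_1,0)=0.$$ Let $(x_0,v_0),(x_1,v_1)\in\mathcal H$ with $x_0\ne x_1$. Put $m=\min(v_0^{-1/2},v_1^{-1/2})$, where $0^{-1/2}=+\infty$ (if $v_0=v_1=0$, the intervals below are $\mathbb R$ and $(0,\infty)$), let $v_{\min}=\min(v_0,v_1)$, $v_{\max}=\max(v_0,v_1)$, and let $T=F\bigl(v_{\min},v_{\max},1/\sqrt{v_{\max}}\bigr)$,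 with $T=0$ if $v_{\max}=0$. (i) If $|x_1-x_0|\le T$, then the equation $$x_1-x_0=\frac{\sqrt{v_0}\sqrt{1-C^2v_0}}{C}-\frac{\arcsin(C\sqrt{v_0})}{C^2}-\left[\frac{\sqrt{v_1}\sqrt{1-C^2v_1}}{C}-\frac{\arcsin(C\sqrt{v_1})}{C^2}\right]$$ (whose right-hand side is $F(v_0,v_1,C)$, understood as $0$ at $C=0$) has a unique solution $C^*$ in the interval $[-m,m]$; it is nonzero, and $$d_H((x_0,v_0),(x_1,v_1))=2\,\frac{\arcsin(C^*\sqrt{v_{\max}})-\arcsin(C^*\sqrt{v_{\min}})}{C^*}.$$ (ii) If $|x_1-x_0|\ge T$, then the equation $$|x_1-x_0|=\frac{\sqrt{v_0}\sqrt{1-C^2v_0}}{C}+\frac{\arccos(C\sqrt{v_0})}{C^2}+\frac{\sqrt{v_1}\sqrt{1-C^2v_1}}{C}+\frac{\arccos(C\sqrt{v_1})}{C^2}$$ has a unique solution $C^*$ with $0<C^*\le m$, and $$d_H((x_0,v_0),(x_1,v_1))=2\,\frac{\arccos(C^*\sqrt{v_0})+\arccos(C^*\sqrt{v_1})}{C^*}.$$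 -/

import Mathlib

/-! The Heston Riemannian distance on the closed half-plane `{(x, v) : v ≥ 0}`, and the functions
that enter its explicit description. -/

namespace Heston

noncomputable section

/-- The closed half-plane `{(x, v) : v ≥ 0}`, the state space of the Heston model. -/
def halfPlane : Set (ℝ × ℝ) := {p | 0 ≤ p.2}

/-- The length of the tangent vector `w` at the point `p` for the Heston metric
`ds² = v⁻¹ (dx² + dv²)`. It is only used at points `p = (x, v)` with `v > 0`. -/
def tangentNorm (p w : ℝ × ℝ) : ℝ := √((p.2)⁻¹ * (w.1 ^ 2 + w.2 ^ 2))

/-- Curves from `p` to `q`, parametrized by `[0, 1]`: continuous on `[0, 1]`, and on `(0, 1)`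
continuously differentiable with values in the open half-plane `{v > 0}`. The endpoints may lie
on the boundary line `{v = 0}`. If both have `v > 0`, the whole curve lies in the open half-plane.
(The velocity may vanish, so corners are possible, and piecewise `C¹` curves can be
reparametrized to be of this form.) -/
structure IsCurve (p q : ℝ × ℝ) (γ : ℝ → ℝ × ℝ) : Prop where
  source : γ 0 = p
  target : γ 1 = q
  continuousOn : ContinuousOn γ (Set.Icc 0 1)
  contDiffOn : ContDiffOn ℝ 1 γ (Set.Ioo 0 1)
  pos : ∀ t ∈ Set.Ioo (0 : ℝ) 1, 0 < (γ t).2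

/-- The (possibly infinite) Heston length of a curve parametrized by `[0, 1]`. -/
def length (γ : ℝ → ℝ × ℝ) : ENNReal :=
  ∫⁻ t in Set.Ioo (0 : ℝ) 1, ENNReal.ofReal (tangentNorm (γ t) (deriv γ t))

/-- The Heston distance: the infimum of the Heston lengths of the curves from `p` to `q`. -/
def dist (p q : ℝ × ℝ) : ℝ :=
  (⨅ (γ : ℝ → ℝ × ℝ) (_ : IsCurve p q γ), length γ).toReal

/-- `F̄(v, C) = arcsin (C √v) / C² - √v √(1 - C² v) / C`, for `C ≠ 0` and `0 ≤ v ≤ C⁻²`. -/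
def Fbar (v C : ℝ) : ℝ :=
  Real.arcsin (C * √v) / C ^ 2 - √v * √(1 - C ^ 2 * v) / C

/-- `F(v₀, v₁, C) = F̄(v₁, C) - F̄(v₀, C)` for `C ≠ 0`, extended by `F(v₀, v₁, 0) = 0`. -/
def F (v₀ v₁ C : ℝ) : ℝ :=
  if C = 0 then 0 else Fbar v₁ C - Fbar v₀ C

/-- The interval `[-m, m]` with `m = min (v₀ ^ (-1/2)) (v₁ ^ (-1/2))`, where `0 ^ (-1/2) = +∞`:
for `v ≥ 0` the bound `|C| ≤ v ^ (-1/2)` is written as `|C| √v ≤ 1`. -/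
def interval (v₀ v₁ : ℝ) : Set ℝ := {C | |C| * √v₀ ≤ 1 ∧ |C| * √v₁ ≤ 1}

/-- The threshold `F(min(v₀, v₁), max(v₀, v₁), 1 / √max(v₀, v₁))` between the two regimes. It is
`0` when `v₀ = v₁`, in particular when `v₀ = v₁ = 0`. -/
def threshold (v₀ v₁ : ℝ) : ℝ := F (min v₀ v₁) (max v₀ v₁) (1 / √(max v₀ v₁))

/-- `C` solves the equation of the close regime on the interval `[-m, m]`. The right-hand side is
`F(v₀, v₁, C)`; at `C = 0`, where it is continued by `0`, Lean's `x / 0 = 0` also gives `0`. -/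
def IsCloseSolution (x₀ v₀ x₁ v₁ C : ℝ) : Prop :=
  C ∈ interval v₀ v₁ ∧
    x₁ - x₀ =
      √v₀ * √(1 - C ^ 2 * v₀) / C - Real.arcsin (C * √v₀) / C ^ 2
        - (√v₁ * √(1 - C ^ 2 * v₁) / C - Real.arcsin (C * √v₁) / C ^ 2)

/-- `C` solves the equation of the far regime on the interval `[0, m]`; the equation is
meaningless at `C = 0`, hence `0 < C`. -/
def IsFarSolution (x₀ v₀ x₁ v₁ C : ℝ) : Prop :=
  (0 < C ∧ C ∈ interval v₀ v₁) ∧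
    |x₁ - x₀| =
      √v₀ * √(1 - C ^ 2 * v₀) / C + Real.arccos (C * √v₀) / C ^ 2
        + √v₁ * √(1 - C ^ 2 * v₁) / C + Real.arccos (C * √v₁) / C ^ 2

end

end Heston

namespace Heston

open MeasureTheory

/-! The distance is found by calibration. For each `C > 0` the four functions `± C x ± potential C
v` solve the eikonal equation `|∇S|² = 1/v` in the strip `C² v ≤ 1`. A curve that stays in the strip
is therefore at least as long as the increment of each of them (`IsCurve.ofReal_le_lintegral`).

A curve need not stay in a prescribed strip, so the strip is adapted to it: let `K⁻²` be its maximal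
height and cut it where that height is attained. The two calibrated pieces give length at least
`archPotential d v₀ v₁ K`, with `d = |x₁ - x₀|`. Since `∂ potential / ∂C = -Fbar`, the derivative of
this bound in `K` is `d - arch v₀ v₁ K`, and `arch` is strictly decreasing. If `arch v₀ v₁ C = d`,
the bound is thus least at `K = C`, which settles the far regime. In the close regime `d ≤ arch v₀
v₁ C`: curves in the strip of `C` are calibrated directly, and for higher ones `K < C`, where the
bound exceeds its value at `C`.

Both bounds are attained by cycloid arcs, which have constant Heston speed in the angle
(`tangentNorm_cycloid`). The arc stops before or at its apex in the close regime and passes through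
or ends at it in the far one. The equations for `C` say that the arc has the right horizontal
extent; monotonicity in `C` and the intermediate value theorem solve them. -/

/-! ### Dependence of `Fbar` on the parameter and on the height. -/

/-- `tan θ - θ` in terms of `u = sin θ`. -/
noncomputable def tanDefect (u : ℝ) : ℝ := u / √(1 - u ^ 2) - Real.arcsin u

theorem hasDerivAt_tanDefect {u : ℝ} (h0 : 0 ≤ u) (h1 : u < 1) :
    HasDerivAt tanDefect (u ^ 2 / (√(1 - u ^ 2)) ^ 3) u := by
  have hpos : 0 < 1 - u ^ 2 := by nlinarith
  have hs : 0 < √(1 - u ^ 2) := Real.sqrt_pos.2 hpos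
  have hs2 : √(1 - u ^ 2) ^ 2 = 1 - u ^ 2 := Real.sq_sqrt hpos.le
  have hsq : HasDerivAt (fun u : ℝ => √(1 - u ^ 2)) (-(2 * u) / (2 * √(1 - u ^ 2))) u := by
    have : HasDerivAt (fun u : ℝ => 1 - u ^ 2) (-(2 * u)) u := by
      simpa using (hasDerivAt_pow 2 u).const_sub 1
    exact this.sqrt hpos.ne'
  have := ((hasDerivAt_id u).div hsq hs.ne').sub
    (Real.hasDerivAt_arcsin (by linarith : u ≠ -1) h1.ne)
  refine this.congr_deriv ?_
  simp only [id]
  set s := √(1 - u ^ 2)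
  field_simp
  rw [hs2]
  ring

theorem strictMonoOn_tanDefect : StrictMonoOn tanDefect (Set.Ico 0 1) := by
  refine strictMonoOn_of_deriv_pos (convex_Ico 0 1) (fun u hu =>
    (hasDerivAt_tanDefect hu.1 hu.2).continuousAt.continuousWithinAt) fun u hu => ?_
  rw [interior_Ico] at hu
  rw [(hasDerivAt_tanDefect hu.1.le hu.2).deriv]
  have hpos : 0 < 1 - u ^ 2 := by nlinarith [hu.1, hu.2]
  have := Real.sqrt_pos.2 hpos
  have := hu.1
  positivity

theorem tanDefect_nonneg {u : ℝ} (h0 : 0 ≤ u) (h1 : u < 1) : 0 ≤ tanDefect u := by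
  have := strictMonoOn_tanDefect.monotoneOn (a := 0) (by simp) (b := u) ⟨h0, h1⟩ h0
  simpa [tanDefect] using this

theorem hasDerivAt_sqrt_one_sub_sq_mul {v K : ℝ} (h : 0 < 1 - K ^ 2 * v) :
    HasDerivAt (fun K : ℝ => √(1 - K ^ 2 * v)) (-(K * v) / √(1 - K ^ 2 * v)) K := by
  have h1 : HasDerivAt (fun K : ℝ => 1 - K ^ 2 * v) (-(2 * K * v)) K := by
    simpa using ((hasDerivAt_pow 2 K).mul_const v).const_sub 1
  refine (h1.sqrt h.ne').congr_deriv ?_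
  have := Real.sqrt_pos.2 h
  field_simp

theorem one_sub_sq_mul_pos {v K : ℝ} (hv : 0 ≤ v) (hK : 0 ≤ K) (h : K * √v < 1) :
    0 < 1 - K ^ 2 * v := by
  have h0 : 0 ≤ K * √v := by positivity
  have : K ^ 2 * v = (K * √v) ^ 2 := by rw [mul_pow, Real.sq_sqrt hv]
  nlinarith

theorem hasDerivAt_arcsin_mul_sqrt {v K : ℝ} (hv : 0 ≤ v) (hK : 0 < K) (h : K * √v < 1) :
    HasDerivAt (fun K => Real.arcsin (K * √v)) (√v / √(1 - K ^ 2 * v)) K := by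
  have h0 : 0 ≤ K * √v := by positivity
  have := (Real.hasDerivAt_arcsin (by linarith : K * √v ≠ -1) h.ne).comp K
    ((hasDerivAt_id K).mul_const √v)
  refine this.congr_deriv ?_
  rw [mul_pow, Real.sq_sqrt hv]
  ring

/-- With `sin θ = K √v` the derivative is `2 (tan θ - θ) / K³`. Nonnegativity of `tan θ - θ` makes
`Fbar` monotone in the parameter, and its growth in `θ` does the same for differences over two
heights. -/
theorem hasDerivAt_Fbar {v K : ℝ} (hv : 0 ≤ v) (hK : 0 < K) (h : K * √v < 1) :
    HasDerivAt (Fbar v) (2 / K ^ 3 * tanDefect (K * √v)) K := by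
  have hpos := one_sub_sq_mul_pos hv hK.le h
  have hs := Real.sqrt_pos.2 hpos
  have hs2 := Real.sq_sqrt hpos.le
  have hr2 := Real.sq_sqrt hv
  have := ((hasDerivAt_arcsin_mul_sqrt hv hK h).div (hasDerivAt_pow 2 K) (by positivity)).sub
    (((hasDerivAt_sqrt_one_sub_sq_mul hpos).const_mul √v).div (hasDerivAt_id K) hK.ne')
  refine this.congr_deriv ?_
  simp only [tanDefect, mul_pow, hr2, id]
  set s := √(1 - K ^ 2 * v)
  set r := √v
  have hv' : K ^ 2 * v = 1 - s ^ 2 := by rw [hs2]; ring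
  field_simp
  push_cast
  linear_combination (K ^ 2 * r) * hv'

/-- No bound on `K √v` is needed, as `arcsin` and `√` are continued by constants. The endpoint `K √v
= 1`, where the derivative formula fails, is thus covered by continuity. -/
theorem continuousOn_Fbar (v : ℝ) : ContinuousOn (Fbar v) (Set.Ioi 0) := by
  unfold Fbar
  refine ContinuousOn.sub (ContinuousOn.div ?_ (by fun_prop) fun K hK => ?_)
    (ContinuousOn.div (by fun_prop) (by fun_prop) fun K hK => (Set.mem_Ioi.1 hK).ne')
  · exact (Real.continuous_arcsin.comp (by fun_prop)).continuousOn
  · have := Set.mem_Ioi.1 hK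
    positivity

theorem mul_sqrt_lt_one {v K m : ℝ} (hK : K < m) (hm : m * √v ≤ 1) :
    K * √v < 1 := by
  rcases (Real.sqrt_nonneg v).eq_or_lt with h | h
  · simp [← h]
  · exact (mul_lt_mul_of_pos_right hK h).trans_le hm

theorem monotoneOn_Fbar {v m : ℝ} (hv : 0 ≤ v) (hm : m * √v ≤ 1) :
    MonotoneOn (Fbar v) (Set.Ioc 0 m) := by
  refine monotoneOn_of_deriv_nonneg (convex_Ioc 0 m)
    ((continuousOn_Fbar v).mono fun K hK => hK.1) (fun K hK => ?_) fun K hK => ?_ <;>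
  rw [interior_Ioc] at hK <;>
  have h1 := mul_sqrt_lt_one hK.2 hm <;>
  have hd := hasDerivAt_Fbar hv hK.1 h1
  · exact hd.differentiableAt.differentiableWithinAt
  · rw [hd.deriv]
    have hK1 := hK.1
    have := tanDefect_nonneg (by positivity) h1
    positivity

theorem strictMonoOn_Fbar_sub {v w m : ℝ} (hv : 0 ≤ v) (hvw : v < w) (hm : m * √w ≤ 1) :
    StrictMonoOn (fun K => Fbar w K - Fbar v K) (Set.Ioc 0 m) := by
  refine strictMonoOn_of_deriv_pos (convex_Ioc 0 m)
    (((continuousOn_Fbar w).sub (continuousOn_Fbar v)).mono fun K hK => hK.1) fun K hK => ?_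
  rw [interior_Ioc] at hK
  have hK1 := hK.1
  have hr := Real.sqrt_lt_sqrt hv hvw
  have h1 := mul_sqrt_lt_one hK.2 hm
  have h2 : K * √v < K * √w := mul_lt_mul_of_pos_left hr hK1
  have hd : HasDerivAt (fun K => Fbar w K - Fbar v K) _ K :=
    (hasDerivAt_Fbar (hv.trans hvw.le) hK.1 h1).sub (hasDerivAt_Fbar hv hK.1 (h2.trans h1))
  rw [hd.deriv, ← mul_sub]
  have := strictMonoOn_tanDefect (a := K * √v) ⟨by positivity, h2.trans h1⟩
    (b := K * √w) ⟨by positivity, h1⟩ h2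
  exact mul_pos (by positivity) (sub_pos.2 this)

theorem Fbar_neg (v C : ℝ) : Fbar v (-C) = -Fbar v C := by
  simp only [Fbar, neg_mul, Real.arcsin_neg, neg_sq]
  ring

theorem Fbar_zero_right (v : ℝ) : Fbar v 0 = 0 := by simp [Fbar]

theorem sqrt_one_sub_sq_mul_eq_cos {v K : ℝ} (hv : 0 ≤ v) :
    √(1 - K ^ 2 * v) = Real.cos (Real.arcsin (K * √v)) := by
  rw [Real.cos_arcsin, mul_pow, Real.sq_sqrt hv]

theorem Fbar_eq {v K : ℝ} (hv : 0 ≤ v) (hK : 0 < K) (h : K * √v ≤ 1) :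
    Fbar v K = (Real.arcsin (K * √v)
      - Real.sin (Real.arcsin (K * √v)) * Real.cos (Real.arcsin (K * √v))) / K ^ 2 := by
  have h0 : 0 ≤ K * √v := by positivity
  rw [Fbar, sqrt_one_sub_sq_mul_eq_cos hv, Real.sin_arcsin (by linarith) h]
  field_simp

/-- The difference of the products is `sin (b - a) cos (b + a)`, less than `b - a` when `b - a ≤ π`.
For larger gaps it suffices that it is at most `1`. -/
theorem sub_sin_mul_cos_lt {a b : ℝ} (hab : a < b) :
    a - Real.sin a * Real.cos a < b - Real.sin b * Real.cos b := by
  rcases le_or_gt (b - a) Real.pi with hp | hp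
  · have h1 : Real.sin b * Real.cos b - Real.sin a * Real.cos a
        = Real.sin (b - a) * Real.cos (b + a) := by
      rw [Real.sin_sub, Real.cos_add]
      linear_combination (-(Real.sin b * Real.cos b)) * Real.sin_sq_add_cos_sq a
        + (Real.sin a * Real.cos a) * Real.sin_sq_add_cos_sq b
    have h2 := Real.sin_nonneg_of_nonneg_of_le_pi (by linarith : 0 ≤ b - a) hp
    have h3 := Real.sin_lt (by linarith : 0 < b - a)
    nlinarith [Real.cos_le_one (b + a)]
  · have := Real.pi_gt_three
    nlinarith [Real.sin_sq_add_cos_sq a, Real.sin_sq_add_cos_sq b,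
      sq_nonneg (Real.sin a + Real.cos a), sq_nonneg (Real.sin b - Real.cos b)]

theorem Fbar_lt_Fbar {v w K : ℝ} (hv : 0 ≤ v) (hvw : v < w) (hK : 0 < K) (h : K * √w ≤ 1) :
    Fbar v K < Fbar w K := by
  have h2 : K * √v < K * √w := mul_lt_mul_of_pos_left (Real.sqrt_lt_sqrt hv hvw) hK
  have h0 : 0 ≤ K * √v := by positivity
  rw [Fbar_eq hv hK (h2.le.trans h), Fbar_eq (hv.trans hvw.le) hK h]
  refine div_lt_div_of_pos_right (sub_sin_mul_cos_lt ?_) (by positivity)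
  exact Real.strictMonoOn_arcsin ⟨by linarith, by linarith⟩ ⟨by linarith, h⟩ h2

theorem Fbar_nonneg {v K : ℝ} (hv : 0 ≤ v) (hK : 0 < K) (h : K * √v ≤ 1) : 0 ≤ Fbar v K := by
  rcases hv.eq_or_lt with rfl | hv'
  · simp [Fbar]
  · simpa [Fbar] using (Fbar_lt_Fbar le_rfl hv' hK h).le

/-- A bound vanishing as `K → 0`, from `θ ≤ tan θ`; it starts the intermediate value argument for
small targets. -/
theorem Fbar_le {v K : ℝ} (hv : 0 ≤ v) (hK : 0 < K) (h : K * √v ≤ 1 / 2) :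
    Fbar v K ≤ 2 * K * (v * √v) := by
  have hpos := one_sub_sq_mul_pos hv hK.le (by linarith)
  have h0 : 0 ≤ K * √v := by positivity
  have hr2 := Real.sq_sqrt hv
  have hs : 1 / 2 ≤ √(1 - K ^ 2 * v) := by
    refine Real.le_sqrt_of_sq_le ?_
    have : K ^ 2 * v = (K * √v) ^ 2 := by rw [mul_pow, hr2]
    nlinarith
  have hs2 := Real.sq_sqrt hpos.le
  have h1 := tanDefect_nonneg h0 (by linarith)
  simp only [tanDefect, mul_pow, hr2] at h1
  rw [Fbar]
  set s := √(1 - K ^ 2 * v)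
  set r := √v
  have hs0 : 0 < s := by linarith
  calc Real.arcsin (K * r) / K ^ 2 - r * s / K ≤ K * r / s / K ^ 2 - r * s / K := by
        gcongr; linarith
    _ = K * (v * r) / s := by
        field_simp
        linear_combination (-r) * hs2
    _ ≤ 2 * K * (v * r) := by
        rw [div_le_iff₀ hs0]
        have : 0 ≤ K * (v * r) := by positivity
        nlinarith

/-! ### Solving the close equation. -/

theorem exists_pos_Fbar_sub_eq {v w d : ℝ} (hv : 0 ≤ v) (hvw : v < w) (hd : 0 < d)
    (h : d ≤ Fbar w (1 / √w) - Fbar v (1 / √w)) :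
    ∃ C : ℝ, 0 < C ∧ C * √w ≤ 1 ∧ Fbar w C - Fbar v C = d := by
  have hw : 0 < w := hv.trans_lt hvw
  have hr : 0 < √w := Real.sqrt_pos.2 hw
  -- The first bound makes `Fbar_le` applicable at `ε`; the second makes its right-hand side at most
  -- `d`.
  set ε := min (1 / (2 * √w)) (d / (2 * (w * √w))) with hε
  have hε0 : 0 < ε := by positivity
  have hε1 : ε * √w ≤ 1 / 2 := by
    calc ε * √w ≤ 1 / (2 * √w) * √w := by gcongr; exact min_le_left _ _
      _ = 1 / 2 := by field_simp
  have hε2 : 2 * ε * (w * √w) ≤ d := by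
    calc 2 * ε * (w * √w) ≤ 2 * (d / (2 * (w * √w))) * (w * √w) := by
          gcongr; exact min_le_right _ _
      _ = d := by field_simp
  have hεm : ε ≤ 1 / √w := by rw [le_div_iff₀ hr]; linarith
  have hrv : √v ≤ √w := Real.sqrt_le_sqrt hvw.le
  have hlow : Fbar w ε - Fbar v ε ≤ d := by
    have h1 := Fbar_le hw.le hε0 hε1
    have h2 := Fbar_nonneg hv hε0 (by nlinarith : ε * √v ≤ 1)
    linarith
  obtain ⟨C, hC, hCd⟩ := intermediate_value_Icc hεm
    (((continuousOn_Fbar w).sub (continuousOn_Fbar v)).mono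
      fun K hK => hε0.trans_le hK.1) ⟨hlow, h⟩
  exact ⟨C, hε0.trans_le hC.1, (le_div_iff₀ hr).1 hC.2, hCd⟩

/-- `Fbar` is odd in `C`, so only `y > 0` matters; then `C' < 0` gives a negative value and `C' = 0`
gives zero. -/
theorem exists_unique_Fbar_sub_eq {v w y : ℝ} (hv : 0 ≤ v) (hvw : v < w) (hy : y ≠ 0)
    (h : |y| ≤ Fbar w (1 / √w) - Fbar v (1 / √w)) :
    ∃ C : ℝ, C ≠ 0 ∧ |C| * √w ≤ 1 ∧ Fbar w C - Fbar v C = y ∧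
      (Fbar w |C| - Fbar v |C| = |y|) ∧
      ∀ C' : ℝ, |C'| * √w ≤ 1 → Fbar w C' - Fbar v C' = y → C' = C := by
  have hr : 0 < √w := Real.sqrt_pos.2 (hv.trans_lt hvw)
  have key : ∀ {y : ℝ}, 0 < y → y ≤ Fbar w (1 / √w) - Fbar v (1 / √w) →
      ∃ C : ℝ, 0 < C ∧ C * √w ≤ 1 ∧ Fbar w C - Fbar v C = y ∧
        ∀ C' : ℝ, |C'| * √w ≤ 1 → Fbar w C' - Fbar v C' = y → C' = C := by
    intro y hy h
    obtain ⟨C, hC0, hC1, hC2⟩ := exists_pos_Fbar_sub_eq hv hvw hy h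
    refine ⟨C, hC0, hC1, hC2, fun C' hC' hC'2 => ?_⟩
    rcases lt_trichotomy C' 0 with hneg | rfl | hpos
    · rw [abs_of_neg hneg] at hC'
      have := Fbar_lt_Fbar hv hvw (neg_pos.2 hneg) hC'
      rw [Fbar_neg, Fbar_neg] at this
      linarith
    · simp only [Fbar_zero_right] at hC'2
      linarith
    · rw [abs_of_pos hpos] at hC'
      have hm : 1 / √w * √w ≤ 1 := by field_simp; rfl
      exact (strictMonoOn_Fbar_sub hv hvw hm).injOn ⟨hpos, by rwa [le_div_iff₀ hr]⟩
        ⟨hC0, by rwa [le_div_iff₀ hr]⟩ (hC'2.trans hC2.symm)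
  rcases hy.lt_or_gt with hneg | hpos
  · rw [abs_of_neg hneg] at h ⊢
    obtain ⟨C, hC0, hC1, hC2, hC3⟩ := key (neg_pos.2 hneg) h
    refine ⟨-C, by simpa using hC0.ne', by rwa [abs_neg, abs_of_pos hC0], ?_, ?_, ?_⟩
    · rw [Fbar_neg, Fbar_neg]; linarith
    · rwa [abs_neg, abs_of_pos hC0]
    · intro C' h1 h2
      rw [← hC3 (-C') (by rwa [abs_neg]) (by rw [Fbar_neg, Fbar_neg]; linarith), neg_neg]
  · rw [abs_of_pos hpos] at h ⊢
    obtain ⟨C, hC0, hC1, hC2, hC3⟩ := key hpos h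
    exact ⟨C, hC0.ne', by rwa [abs_of_pos hC0], hC2, by rwa [abs_of_pos hC0], hC3⟩

/-! ### Solving the far equation: the extent of an arch. -/

/-- The horizontal extent of the cycloid arc with parameter `C` that starts at height `v₀`, passes
through its apex and ends at height `v₁`. -/
noncomputable def arch (v₀ v₁ C : ℝ) : ℝ := Real.pi / C ^ 2 - Fbar v₀ C - Fbar v₁ C

theorem arch_eq (v₀ v₁ C : ℝ) :
    arch v₀ v₁ C = √v₀ * √(1 - C ^ 2 * v₀) / C + Real.arccos (C * √v₀) / C ^ 2
        + √v₁ * √(1 - C ^ 2 * v₁) / C + Real.arccos (C * √v₁) / C ^ 2 := by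
  simp only [arch, Fbar, Real.arccos]
  ring

theorem strictAntiOn_arch {v₀ v₁ m : ℝ} (h₀ : 0 ≤ v₀) (h₁ : 0 ≤ v₁)
    (hm₀ : m * √v₀ ≤ 1) (hm₁ : m * √v₁ ≤ 1) : StrictAntiOn (arch v₀ v₁) (Set.Ioc 0 m) := by
  intro a ha b hb hab
  have e0 := monotoneOn_Fbar h₀ hm₀ ha hb hab.le
  have e1 := monotoneOn_Fbar h₁ hm₁ ha hb hab.le
  have ha0 := ha.1
  have : Real.pi / b ^ 2 < Real.pi / a ^ 2 :=
    div_lt_div_of_pos_left Real.pi_pos (by positivity) (by gcongr)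
  simp only [arch]
  linarith

theorem continuousOn_arch (v₀ v₁ : ℝ) : ContinuousOn (arch v₀ v₁) (Set.Ioi 0) := by
  unfold arch
  refine ((ContinuousOn.div (by fun_prop) (by fun_prop) fun K hK => ?_).sub
    (continuousOn_Fbar v₀)).sub (continuousOn_Fbar v₁)
  have := Set.mem_Ioi.1 hK
  positivity

theorem exists_arch_ge {v₀ v₁ d m : ℝ} (hm : 0 < m) (hd : 0 < d) :
    ∃ ε : ℝ, 0 < ε ∧ ε ≤ m ∧ d ≤ arch v₀ v₁ ε := by
  -- One bound gives `ε √v₀ ≤ 1/2`, so the arccosine is at least `π/3 ≥ 1`; the other gives `1/ε² ≥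
  -- d`.
  set ε := min m (min (1 / (2 * (√v₀ + 1))) (1 / √d)) with hε
  have hr := Real.sqrt_nonneg v₀
  have hs := Real.sqrt_pos.2 hd
  have hε0 : 0 < ε := by positivity
  have h1 : ε ≤ 1 / (2 * (√v₀ + 1)) := (min_le_right _ _).trans (min_le_left _ _)
  have h2 : ε ≤ 1 / √d := (min_le_right _ _).trans (min_le_right _ _)
  rw [le_div_iff₀ (by positivity)] at h1 h2
  refine ⟨ε, hε0, min_le_left _ _, ?_⟩
  rw [arch_eq]
  have h3 : 1 ≤ Real.arccos (ε * √v₀) := by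
    have e1 : Real.arccos (1 / 2) = Real.pi / 3 := by
      rw [← Real.cos_pi_div_three, Real.arccos_cos] <;> linarith [Real.pi_pos]
    have e2 := Real.arccos_le_arccos (show ε * √v₀ ≤ 1 / 2 by nlinarith)
    linarith [Real.pi_gt_three]
  have h4 : d ≤ Real.arccos (ε * √v₀) / ε ^ 2 := by
    rw [le_div_iff₀ (by positivity)]
    have : d * ε ^ 2 = (ε * √d) ^ 2 := by rw [mul_pow, Real.sq_sqrt hd.le]; ring
    nlinarith [mul_pos hε0 hs]
  have h5 := Real.arccos_nonneg (ε * √v₁)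
  have : 0 ≤ √v₀ * √(1 - ε ^ 2 * v₀) / ε := by positivity
  have : 0 ≤ √v₁ * √(1 - ε ^ 2 * v₁) / ε := by positivity
  have : 0 ≤ Real.arccos (ε * √v₁) / ε ^ 2 := by positivity
  linarith

/-! ### The eikonal potential. -/

/-- A solution `S = C x ± potential C v` of the eikonal equation of the Heston metric in the strip
`C² v ≤ 1`. -/
noncomputable def potential (C v : ℝ) : ℝ := Real.arcsin (C * √v) / C + √v * √(1 - C ^ 2 * v)

theorem continuous_potential (C : ℝ) : Continuous (potential C) := by
  unfold potential
  exact ((Real.continuous_arcsin.comp (by fun_prop)).div_const C).add (by fun_prop)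

theorem continuousOn_potential_left (v : ℝ) :
    ContinuousOn (fun C => potential C v) (Set.Ioi 0) := by
  unfold potential
  exact (ContinuousOn.div (Real.continuous_arcsin.comp (by fun_prop)).continuousOn (by fun_prop)
    fun K hK => (Set.mem_Ioi.1 hK).ne').add (by fun_prop)

theorem hasDerivAt_potential_left {v K : ℝ} (hv : 0 ≤ v) (hK : 0 < K) (h : K * √v < 1) :
    HasDerivAt (fun K => potential K v) (-Fbar v K) K := by
  have hpos := one_sub_sq_mul_pos hv hK.le h
  have hs := Real.sqrt_pos.2 hpos
  have hs2 := Real.sq_sqrt hpos.le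
  have := ((hasDerivAt_arcsin_mul_sqrt hv hK h).div (hasDerivAt_id K) hK.ne').add
    ((hasDerivAt_sqrt_one_sub_sq_mul hpos).const_mul √v)
  refine this.congr_deriv ?_
  simp only [Fbar, id]
  set s := √(1 - K ^ 2 * v)
  set r := √v
  field_simp
  linear_combination (-(K * r)) * hs2

theorem hasDerivAt_potential_of_ne {C v : ℝ} (hC : 0 < C) (hv : 0 < v) (hne : C ^ 2 * v ≠ 1) :
    HasDerivAt (potential C) (√(1 - C ^ 2 * v) / √v) v := by
  have hr : 0 < √v := Real.sqrt_pos.2 hv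
  have hr2 := Real.sq_sqrt hv.le
  have hcv : (C * √v) ^ 2 = C ^ 2 * v := by rw [mul_pow, hr2]
  rcases hne.lt_or_gt with h | h
  · have hpos : 0 < 1 - C ^ 2 * v := by linarith
    have hs := Real.sqrt_pos.2 hpos
    have hs2 := Real.sq_sqrt hpos.le
    have hlt : C * √v < 1 := by nlinarith [mul_pos hC hr]
    have h1 := (Real.hasDerivAt_arcsin (by nlinarith [mul_pos hC hr] : C * √v ≠ -1) hlt.ne).comp v
      ((Real.hasDerivAt_sqrt hv.ne').const_mul C)
    have h2 : HasDerivAt (fun v => 1 - C ^ 2 * v) (-C ^ 2) v := by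
      simpa using ((hasDerivAt_id v).const_mul (C ^ 2)).const_sub 1
    have := (h1.div_const C).add ((Real.hasDerivAt_sqrt hv.ne').mul (h2.sqrt hpos.ne'))
    refine this.congr_deriv ?_
    rw [hcv]
    set s := √(1 - C ^ 2 * v)
    set r := √v
    field_simp
    linear_combination (-1) * hs2 - C ^ 2 * hr2
  -- Above the strip the potential is constant, equal to `π / (2C)`, and `√` of a negative number is
  -- `0`, so the formula persists.
  · clear hcv
    have hz : √(1 - C ^ 2 * v) = 0 := Real.sqrt_eq_zero_of_nonpos (by linarith)
    rw [hz, zero_div]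
    refine (hasDerivAt_const v (Real.pi / 2 / C)).congr_of_eventuallyEq ?_
    have : ∀ᶠ w in nhds v, 1 < C ^ 2 * w :=
      (continuous_const.mul continuous_id).continuousAt.eventually (lt_mem_nhds h)
    filter_upwards [this, lt_mem_nhds hv] with w hw hw0
    have h1 : 1 ≤ C * √w := by
      have : (C * √w) ^ 2 = C ^ 2 * w := by rw [mul_pow, Real.sq_sqrt (le_of_lt hw0)]
      nlinarith [mul_nonneg hC.le (Real.sqrt_nonneg w)]
    have h2 : 1 - C ^ 2 * w ≤ 0 := sub_nonpos.2 (le_of_lt hw)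
    rw [potential, Real.arcsin_of_one_le h1, Real.sqrt_eq_zero_of_nonpos h2]
    simp

/-- Curves may touch the line `C² v = 1`, where neither summand is differentiable. The derivative
nearby extends continuously there, which suffices; substituting `v = exp y` turns `v > 0` into the
whole line, as the removal lemma requires. -/
theorem hasDerivAt_potential {C v : ℝ} (hC : 0 < C) (hv : 0 < v) :
    HasDerivAt (potential C) (√(1 - C ^ 2 * v) / √v) v := by
  by_cases hne : C ^ 2 * v = 1
  swap
  · exact hasDerivAt_potential_of_ne hC hv hne
  have key := hasDerivAt_of_hasDerivAt_of_ne (f := fun y => potential C (Real.exp y))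
    (g := fun y => √(1 - C ^ 2 * Real.exp y) / √(Real.exp y) * Real.exp y) (x := Real.log v)
    (fun y hy => ?_) ((continuous_potential C).comp Real.continuous_exp).continuousAt ?_
  · rw [← Real.exp_log hv] at hne
    have := key.comp v (Real.hasDerivAt_log hv.ne')
    rw [Real.exp_log hv] at this
    refine (this.congr_of_eventuallyEq ?_).congr_deriv ?_
    · filter_upwards [lt_mem_nhds hv] with w hw
      simp [Real.exp_log hw]
    · field_simp
  · refine (hasDerivAt_potential_of_ne hC (Real.exp_pos y) fun h => hy ?_).comp y
      (Real.hasDerivAt_exp y)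
    rw [← Real.log_exp y, mul_left_cancel₀ (by positivity) (h.trans hne.symm)]
  · refine (ContinuousAt.div (by fun_prop) (by fun_prop) ?_).mul (by fun_prop)
    positivity

/-! ### Lower bounds for the length by calibration. -/

theorem ofReal_sub_le_lintegral {f f' g : ℝ → ℝ} {a b : ℝ} (hab : a ≤ b)
    (hf : ContinuousOn f (Set.Icc a b)) (hf' : ∀ t ∈ Set.Ioo a b, HasDerivAt f (f' t) t)
    (hg : ContinuousOn g (Set.Ioo a b)) (hg0 : ∀ t, 0 ≤ g t)
    (hle : ∀ t ∈ Set.Ioo a b, f' t ≤ g t) :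
    ENNReal.ofReal (f b - f a) ≤ ∫⁻ t in Set.Ioo a b, ENNReal.ofReal (g t) := by
  by_cases htop : ∫⁻ t in Set.Ioo a b, ENNReal.ofReal (g t) = ⊤
  · rw [htop]; exact le_top
  have hint : IntegrableOn g (Set.Ioo a b) := by
    refine ⟨hg.aestronglyMeasurable measurableSet_Ioo, ?_⟩
    rw [hasFiniteIntegral_iff_ofReal (Filter.Eventually.of_forall hg0)]
    exact lt_top_iff_ne_top.2 htop
  have h := intervalIntegral.sub_le_integral_of_hasDeriv_right_of_le hab hf
    (fun t ht => (hf' t ht).hasDerivWithinAt) ((integrableOn_Icc_iff_integrableOn_Ioo).2 hint) hle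
  rw [intervalIntegral.integral_of_le hab, integral_Ioc_eq_integral_Ioo] at h
  rw [← ofReal_integral_eq_lintegral_ofReal hint (Filter.Eventually.of_forall hg0)]
  exact ENNReal.ofReal_le_ofReal h

/-- Cauchy–Schwarz, in the form of Lagrange's identity: the gradient `(ε C, δ A)` has squared
Euclidean norm `C² + A² = 1/v`. -/
theorem eikonal_le_tangentNorm {C ε δ : ℝ} (hε : ε ^ 2 = 1) (hδ : δ ^ 2 = 1) {p w : ℝ × ℝ}
    (hp : 0 < p.2) (hC : C ^ 2 * p.2 ≤ 1) :
    ε * (C * w.1) + δ * (√(1 - C ^ 2 * p.2) / √p.2 * w.2) ≤ tangentNorm p w := by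
  refine Real.le_sqrt_of_sq_le ?_
  have hs2 := Real.sq_sqrt (sub_nonneg.2 hC)
  have hr2 := Real.sq_sqrt hp.le
  have hr := Real.sqrt_pos.2 hp
  set A := √(1 - C ^ 2 * p.2) / √p.2 with hA
  have hA2 : C ^ 2 + A ^ 2 = p.2⁻¹ := by
    rw [hA, div_pow, hs2, hr2]
    field_simp
    ring
  rw [← hA2]
  have : (C ^ 2 + A ^ 2) * (w.1 ^ 2 + w.2 ^ 2) - (ε * (C * w.1) + δ * (A * w.2)) ^ 2
      = (ε * C * w.2 - δ * A * w.1) ^ 2 := by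
    linear_combination (-(C ^ 2 * w.1 ^ 2 + C ^ 2 * w.2 ^ 2)) * hε
      - (A ^ 2 * w.1 ^ 2 + A ^ 2 * w.2 ^ 2) * hδ
  nlinarith [sq_nonneg (ε * C * w.2 - δ * A * w.1)]

theorem tangentNorm_nonneg (p w : ℝ × ℝ) : 0 ≤ tangentNorm p w := Real.sqrt_nonneg _

section Curve

variable {p q : ℝ × ℝ} {γ : ℝ → ℝ × ℝ}

theorem IsCurve.hasDerivAt (hγ : IsCurve p q γ) {t : ℝ} (ht : t ∈ Set.Ioo (0 : ℝ) 1) :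
    HasDerivAt γ (deriv γ t) t :=
  ((hγ.contDiffOn.differentiableOn one_ne_zero).differentiableAt
    (isOpen_Ioo.mem_nhds ht)).hasDerivAt

theorem IsCurve.continuousOn_tangentNorm (hγ : IsCurve p q γ) :
    ContinuousOn (fun t => tangentNorm (γ t) (deriv γ t)) (Set.Ioo 0 1) := by
  have hc := hγ.contDiffOn.continuousOn
  have hd := hγ.contDiffOn.continuousOn_deriv_of_isOpen isOpen_Ioo le_rfl
  unfold tangentNorm
  exact ((hc.snd.inv₀ fun t ht => (hγ.pos t ht).ne').mul
    ((hd.fst.pow 2).add (hd.snd.pow 2))).sqrt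

theorem IsCurve.ofReal_le_lintegral_of_sign (hγ : IsCurve p q γ) {a b C ε δ : ℝ} (ha : 0 ≤ a)
    (hab : a ≤ b) (hb : b ≤ 1) (hC : 0 < C) (hle : ∀ t ∈ Set.Icc a b, C ^ 2 * (γ t).2 ≤ 1)
    (hε : ε ^ 2 = 1) (hδ : δ ^ 2 = 1) :
    ENNReal.ofReal (ε * (C * ((γ b).1 - (γ a).1))
        + δ * (potential C (γ b).2 - potential C (γ a).2))
      ≤ ∫⁻ t in Set.Ioo a b, ENNReal.ofReal (tangentNorm (γ t) (deriv γ t)) := by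
  have hsub : Set.Ioo a b ⊆ Set.Ioo 0 1 := Set.Ioo_subset_Ioo ha hb
  have hcont := hγ.continuousOn.mono (Set.Icc_subset_Icc ha hb)
  have := ofReal_sub_le_lintegral
    (f := fun t => ε * (C * (γ t).1) + δ * potential C (γ t).2)
    (f' := fun t => ε * (C * (deriv γ t).1)
      + δ * (√(1 - C ^ 2 * (γ t).2) / √(γ t).2 * (deriv γ t).2))
    hab ?_ ?_ (hγ.continuousOn_tangentNorm.mono hsub) (fun t => tangentNorm_nonneg _ _)
    fun t ht => eikonal_le_tangentNorm hε hδ (hγ.pos t (hsub ht))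
      (hle t (Set.Ioo_subset_Icc_self ht))
  · refine le_trans (le_of_eq ?_) this
    congr 1
    ring
  · exact (continuousOn_const.mul (continuousOn_const.mul hcont.fst)).add
      (continuousOn_const.mul ((continuous_potential C).comp_continuousOn hcont.snd))
  · intro t ht
    have hd := hγ.hasDerivAt (hsub ht)
    have h1 : HasDerivAt (fun t => (γ t).1) (deriv γ t).1 t := hd.fst
    have h2 : HasDerivAt (fun t => (γ t).2) (deriv γ t).2 t := hd.snd
    have h3 := HasDerivAt.comp t (hasDerivAt_potential hC (hγ.pos t (hsub ht))) h2
    exact ((h1.const_mul C).const_mul ε).add (h3.const_mul δ)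

theorem exists_sq_eq_one_mul_eq_abs (x : ℝ) : ∃ ε : ℝ, ε ^ 2 = 1 ∧ ε * x = |x| := by
  rcases le_total 0 x with h | h
  · exact ⟨1, by norm_num, by rw [abs_of_nonneg h, one_mul]⟩
  · exact ⟨-1, by norm_num, by rw [abs_of_nonpos h, neg_one_mul]⟩

theorem IsCurve.ofReal_le_lintegral (hγ : IsCurve p q γ) {a b C : ℝ} (ha : 0 ≤ a)
    (hab : a ≤ b) (hb : b ≤ 1) (hC : 0 < C) (hle : ∀ t ∈ Set.Icc a b, C ^ 2 * (γ t).2 ≤ 1) :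
    ENNReal.ofReal (C * |(γ b).1 - (γ a).1| + |potential C (γ b).2 - potential C (γ a).2|)
      ≤ ∫⁻ t in Set.Ioo a b, ENNReal.ofReal (tangentNorm (γ t) (deriv γ t)) := by
  obtain ⟨ε, hε, h1⟩ := exists_sq_eq_one_mul_eq_abs ((γ b).1 - (γ a).1)
  obtain ⟨δ, hδ, h2⟩ := exists_sq_eq_one_mul_eq_abs (potential C (γ b).2 - potential C (γ a).2)
  rw [← h1, ← h2, mul_left_comm]
  exact hγ.ofReal_le_lintegral_of_sign ha hab hb hC hle hε hδ

/-- The length of a path over an arc of height `C⁻²` that consists of two calibrated pieces, as a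
function of the horizontal distance `d` and the heights of the endpoints. -/
noncomputable def archPotential (d v₀ v₁ C : ℝ) : ℝ :=
  C * d + Real.pi / C - potential C v₀ - potential C v₁

theorem potential_of_sq_mul_eq_one {C v : ℝ} (hC : 0 < C) (h : C ^ 2 * v = 1) :
    potential C v = Real.pi / 2 / C := by
  have hv : v = (1 / C) ^ 2 := by field_simp; linarith
  have h1 : C * √v = 1 := by
    rw [hv, Real.sqrt_sq (by positivity)]
    field_simp
  rw [potential, h1, h, Real.arcsin_one]
  simp

/-- Every curve has a maximal height; it is long in terms of that height. -/
theorem IsCurve.exists_height (hγ : IsCurve p q γ) :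
    ∃ K : ℝ, 0 < K ∧ K * √p.2 ≤ 1 ∧ K * √q.2 ≤ 1 ∧
      (∀ t ∈ Set.Icc (0 : ℝ) 1, K ^ 2 * (γ t).2 ≤ 1) ∧
      ENNReal.ofReal (archPotential |q.1 - p.1| p.2 q.2 K) ≤ length γ := by
  obtain ⟨s, hs, hmax⟩ := isCompact_Icc.exists_isMaxOn (Set.nonempty_Icc.2 zero_le_one)
    hγ.continuousOn.snd
  have hmax' : ∀ t ∈ Set.Icc (0 : ℝ) 1, (γ t).2 ≤ (γ s).2 := fun t ht => hmax ht
  -- Both endpoints may have height zero, so positivity comes from an interior time.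
  have hV : 0 < (γ s).2 :=
    (hγ.pos (1 / 2) (by norm_num)).trans_le (hmax' (1 / 2) (by norm_num))
  have hr := Real.sqrt_pos.2 hV
  have hr2 := Real.sq_sqrt hV.le
  set K := 1 / √(γ s).2 with hK
  have hK0 : 0 < K := by positivity
  have hKs : K ^ 2 * (γ s).2 = 1 := by rw [hK, div_pow, hr2]; field_simp
  have hle : ∀ t ∈ Set.Icc (0 : ℝ) 1, K ^ 2 * (γ t).2 ≤ 1 := fun t ht => by
    rw [← hKs]
    exact mul_le_mul_of_nonneg_left (hmax' t ht) (by positivity)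
  have hroot : ∀ t ∈ Set.Icc (0 : ℝ) 1, K * √(γ t).2 ≤ 1 := fun t ht => by
    rw [hK, one_div, inv_mul_le_iff₀ hr, mul_one]
    exact Real.sqrt_le_sqrt (hmax' t ht)
  refine ⟨K, hK0, ?_, ?_, hle, ?_⟩
  · simpa [hγ.source] using hroot 0 (by simp)
  · simpa [hγ.target] using hroot 1 (by simp)
  have h1 := hγ.ofReal_le_lintegral le_rfl hs.1 hs.2 hK0
    fun t ht => hle t ⟨ht.1, ht.2.trans hs.2⟩
  have h2 := hγ.ofReal_le_lintegral hs.1 hs.2 le_rfl hK0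
    fun t ht => hle t ⟨hs.1.trans ht.1, ht.2⟩
  rw [hγ.source] at h1
  rw [hγ.target] at h2
  calc ENNReal.ofReal (archPotential |q.1 - p.1| p.2 q.2 K)
      ≤ ENNReal.ofReal ((K * |(γ s).1 - p.1| + |potential K (γ s).2 - potential K p.2|)
          + (K * |q.1 - (γ s).1| + |potential K q.2 - potential K (γ s).2|)) := by
        refine ENNReal.ofReal_le_ofReal ?_
        have e1 := le_abs_self (potential K (γ s).2 - potential K p.2)
        have e2 := neg_abs_le (potential K q.2 - potential K (γ s).2)
        have e3 : K * |q.1 - p.1| ≤ K * |(γ s).1 - p.1| + K * |q.1 - (γ s).1| := by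
          rw [← mul_add, add_comm]
          exact mul_le_mul_of_nonneg_left (abs_sub_le _ _ _) hK0.le
        -- At the top the potential is `π / (2K)`; the two pieces together contribute `π / K`.
        have e4 := potential_of_sq_mul_eq_one hK0 hKs
        have e5 : Real.pi / K = 2 * (Real.pi / 2 / K) := by ring
        rw [archPotential, e5]
        linarith
    _ ≤ _ := by
        rw [ENNReal.ofReal_add (by positivity) (by positivity)]
        refine (add_le_add h1 h2).trans ?_
        have hdisj : Disjoint (Set.Ioo 0 s) (Set.Ioo s 1) :=
          Set.disjoint_left.2 fun t ht ht' => lt_asymm ht.2 ht'.1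
        rw [← lintegral_union measurableSet_Ioo hdisj]
        exact lintegral_mono_set (Set.union_subset (Set.Ioo_subset_Ioo_right hs.2)
          (Set.Ioo_subset_Ioo_left hs.1))

end Curve

/-! ### Minimizing the bound over the maximal height. -/

theorem hasDerivAt_archPotential {d v₀ v₁ K : ℝ} (h₀ : 0 ≤ v₀) (h₁ : 0 ≤ v₁) (hK : 0 < K)
    (hK₀ : K * √v₀ < 1) (hK₁ : K * √v₁ < 1) :
    HasDerivAt (archPotential d v₀ v₁) (d - arch v₀ v₁ K) K := by
  have := ((((hasDerivAt_id K).mul_const d).add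
    ((hasDerivAt_const K Real.pi).div (hasDerivAt_id K) hK.ne')).sub
    (hasDerivAt_potential_left h₀ hK hK₀)).sub (hasDerivAt_potential_left h₁ hK hK₁)
  refine this.congr_deriv ?_
  simp only [arch, id]
  ring

theorem continuousOn_archPotential (d v₀ v₁ : ℝ) :
    ContinuousOn (archPotential d v₀ v₁) (Set.Ioi 0) := by
  unfold archPotential
  exact (((by fun_prop : ContinuousOn (fun C : ℝ => C * d) (Set.Ioi 0)).add
    (continuousOn_const.div continuousOn_id fun K hK => (Set.mem_Ioi.1 hK).ne')).sub
    (continuousOn_potential_left v₀)).sub (continuousOn_potential_left v₁)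

theorem archPotential_le_of_le {d v₀ v₁ C K : ℝ} (h₀ : 0 ≤ v₀) (h₁ : 0 ≤ v₁) (hK : 0 < K)
    (hKC : K ≤ C) (hC₀ : C * √v₀ ≤ 1) (hC₁ : C * √v₁ ≤ 1) (hd : d ≤ arch v₀ v₁ C) :
    archPotential d v₀ v₁ C ≤ archPotential d v₀ v₁ K := by
  refine antitoneOn_of_deriv_nonpos (convex_Icc K C)
    ((continuousOn_archPotential d v₀ v₁).mono fun t ht => hK.trans_le ht.1)
    (fun t ht => ?_) (fun t ht => ?_) ⟨le_rfl, hKC⟩ ⟨hKC, le_rfl⟩ hKC <;>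
  rw [interior_Icc] at ht <;>
  have hder := hasDerivAt_archPotential (d := d) h₀ h₁ (hK.trans ht.1)
    (mul_sqrt_lt_one ht.2 hC₀) (mul_sqrt_lt_one ht.2 hC₁)
  · exact hder.differentiableAt.differentiableWithinAt
  · rw [hder.deriv]
    have := strictAntiOn_arch h₀ h₁ hC₀ hC₁ ⟨hK.trans ht.1, ht.2.le⟩
      ⟨hK.trans_le hKC, le_rfl⟩ ht.2
    linarith

theorem archPotential_le_of_ge {d v₀ v₁ C K : ℝ} (h₀ : 0 ≤ v₀) (h₁ : 0 ≤ v₁) (hC : 0 < C)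
    (hCK : C ≤ K) (hK₀ : K * √v₀ ≤ 1) (hK₁ : K * √v₁ ≤ 1) (hd : arch v₀ v₁ C ≤ d) :
    archPotential d v₀ v₁ C ≤ archPotential d v₀ v₁ K := by
  refine monotoneOn_of_deriv_nonneg (convex_Icc C K)
    ((continuousOn_archPotential d v₀ v₁).mono fun t ht => hC.trans_le ht.1)
    (fun t ht => ?_) (fun t ht => ?_) ⟨le_rfl, hCK⟩ ⟨hCK, le_rfl⟩ hCK <;>
  rw [interior_Icc] at ht <;>
  have hder := hasDerivAt_archPotential (d := d) h₀ h₁ (hC.trans ht.1)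
    (mul_sqrt_lt_one ht.2 hK₀) (mul_sqrt_lt_one ht.2 hK₁)
  · exact hder.differentiableAt.differentiableWithinAt
  · rw [hder.deriv]
    have := strictAntiOn_arch h₀ h₁ hK₀ hK₁ ⟨hC, hCK⟩
      ⟨hC.trans ht.1, ht.2.le⟩ ht.1
    linarith

theorem potential_add_mul_Fbar {C : ℝ} (hC : C ≠ 0) (v : ℝ) :
    potential C v + C * Fbar v C = 2 * Real.arcsin (C * √v) / C := by
  simp only [potential, Fbar]
  field_simp
  ring

theorem Fbar_le_pi_div {C : ℝ} (hC : 0 < C) (v : ℝ) : Fbar v C ≤ Real.pi / 2 / C ^ 2 := by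
  have h1 := div_le_div_of_nonneg_right (Real.arcsin_le_pi_div_two (C * √v)) (sq_nonneg C)
  have h2 : 0 ≤ √v * √(1 - C ^ 2 * v) / C := by positivity
  rw [Fbar]
  linarith

theorem potential_le_pi_div {C v : ℝ} (hC : 0 < C) (hv : 0 ≤ v) (h : C * √v ≤ 1) :
    potential C v ≤ Real.pi / 2 / C := by
  have h0 : 0 ≤ C * √v := by positivity
  have key : Real.arcsin (C * √v)
      + Real.sin (Real.arcsin (C * √v)) * Real.cos (Real.arcsin (C * √v)) ≤ Real.pi / 2 := by
    set θ := Real.arcsin (C * √v) with hθ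
    rcases (Real.arcsin_le_pi_div_two (C * √v)).eq_or_lt with h | h
    · rw [← hθ] at h
      simp [h]
    -- Applied to `0 < π/2 - θ`, where the complementary angle swaps sine and cosine.
    · have := sub_sin_mul_cos_lt (sub_pos.2 h)
      rw [← hθ, Real.sin_pi_div_two_sub, Real.cos_pi_div_two_sub, Real.sin_zero] at this
      linarith
  have : potential C v = (Real.arcsin (C * √v)
      + Real.sin (Real.arcsin (C * √v)) * Real.cos (Real.arcsin (C * √v))) / C := by
    rw [potential, sqrt_one_sub_sq_mul_eq_cos hv, Real.sin_arcsin (by linarith) h]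
    field_simp
  rw [this]
  exact div_le_div_of_nonneg_right key hC.le

section LowerBounds

variable {p q : ℝ × ℝ} {γ : ℝ → ℝ × ℝ}

/-- If the curve stays in the strip of `C`, one calibration suffices. Otherwise `K < C`, and
`archPotential` at `C` already dominates the claim because both potentials are at most `π / (2C)`.
-/
theorem IsCurve.le_length_of_le_arch (hγ : IsCurve p q γ) {C : ℝ} (hp : 0 ≤ p.2) (hq : 0 ≤ q.2)
    (hC : 0 < C) (hCp : C * √p.2 ≤ 1) (hCq : C * √q.2 ≤ 1)
    (hd : |q.1 - p.1| ≤ arch p.2 q.2 C) :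
    ENNReal.ofReal (C * |q.1 - p.1| + |potential C q.2 - potential C p.2|) ≤ length γ := by
  obtain ⟨K, hK, -, -, hle, hlen⟩ := hγ.exists_height
  rcases le_or_gt C K with h | h
  · have := hγ.ofReal_le_lintegral le_rfl zero_le_one le_rfl hC fun t ht => by
      have h0 : 0 ≤ (γ t).2 := by
        rcases ht.1.eq_or_lt with rfl | h1
        · rwa [hγ.source]
        rcases ht.2.eq_or_lt with rfl | h2
        · rwa [hγ.target]
        exact (hγ.pos t ⟨h1, h2⟩).le
      refine le_trans ?_ (hle t ht)
      gcongr
    rwa [hγ.source, hγ.target] at this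
  · refine le_trans (ENNReal.ofReal_le_ofReal ?_) hlen
    refine le_trans ?_ (archPotential_le_of_le hp hq hK h.le hCp hCq hd)
    have e1 := potential_le_pi_div hC hp hCp
    have e2 := potential_le_pi_div hC hq hCq
    have e3 : Real.pi / C = 2 * (Real.pi / 2 / C) := by ring
    rw [archPotential, e3]
    rcases abs_cases (potential C q.2 - potential C p.2) with h | h <;> linarith

theorem IsCurve.le_length_of_eq_arch (hγ : IsCurve p q γ) {C : ℝ} (hp : 0 ≤ p.2) (hq : 0 ≤ q.2)
    (hC : 0 < C) (hCp : C * √p.2 ≤ 1) (hCq : C * √q.2 ≤ 1)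
    (hd : |q.1 - p.1| = arch p.2 q.2 C) :
    ENNReal.ofReal (archPotential |q.1 - p.1| p.2 q.2 C) ≤ length γ := by
  obtain ⟨K, hK, hKp, hKq, -, hlen⟩ := hγ.exists_height
  refine le_trans (ENNReal.ofReal_le_ofReal ?_) hlen
  rcases le_total K C with h | h
  · exact archPotential_le_of_le hp hq hK h hCp hCq hd.le
  · exact archPotential_le_of_ge hp hq hC h hKp hKq hd.ge

end LowerBounds

/-! ### Cycloid arcs attain the bounds. -/

/-- The cycloid of parameter `C` through the cusp-based abscissa `x`, as a function of the
angle `θ`, traversed to the right for `σ = 1` and to the left for `σ = -1`. -/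
noncomputable def cycloid (x σ C θ : ℝ) : ℝ × ℝ :=
  (x + σ * ((θ - Real.sin θ * Real.cos θ) / C ^ 2), Real.sin θ ^ 2 / C ^ 2)

theorem hasDerivAt_cycloid (x σ C θ : ℝ) :
    HasDerivAt (cycloid x σ C)
      (σ * (2 * Real.sin θ ^ 2 / C ^ 2), 2 * Real.sin θ * Real.cos θ / C ^ 2) θ := by
  have hs := Real.hasDerivAt_sin θ
  have hc := Real.hasDerivAt_cos θ
  have h1 := (((((hasDerivAt_id θ).sub (hs.mul hc)).div_const (C ^ 2)).const_mul σ).const_add x)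
  have h2 := (hs.pow 2).div_const (C ^ 2)
  refine (h1.prodMk h2).congr_deriv ?_
  ext
  · dsimp only
    congr 2
    linear_combination -Real.sin_sq_add_cos_sq θ
  · simp

theorem tangentNorm_cycloid {x σ C θ c : ℝ} (hσ : σ ^ 2 = 1) (hC : 0 < C)
    (hθ : Real.sin θ ≠ 0) :
    tangentNorm (cycloid x σ C θ)
      (c • (σ * (2 * Real.sin θ ^ 2 / C ^ 2), 2 * Real.sin θ * Real.cos θ / C ^ 2))
      = 2 * |c| / C := by
  have h : (Real.sin θ ^ 2 / C ^ 2)⁻¹ * ((c * (σ * (2 * Real.sin θ ^ 2 / C ^ 2))) ^ 2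
      + (c * (2 * Real.sin θ * Real.cos θ / C ^ 2)) ^ 2) = (2 * |c| / C) ^ 2 := by
    rw [div_pow, mul_pow 2 |c|, sq_abs]
    field_simp
    rw [hσ]
    linear_combination c ^ 2 * Real.sin_sq_add_cos_sq θ
  simp only [tangentNorm, cycloid, Prod.smul_mk, smul_eq_mul]
  rw [h, Real.sqrt_sq (by positivity)]

/-- A cycloid arc whose angle ranges over a subinterval of `[0, π]`. -/
theorem exists_curve_cycloid {x σ C α β : ℝ} (hσ : σ ^ 2 = 1) (hC : 0 < C)
    (hα : α ∈ Set.Icc 0 Real.pi) (hβ : β ∈ Set.Icc 0 Real.pi) (hαβ : α ≠ β) :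
    ∃ γ, IsCurve (cycloid x σ C α) (cycloid x σ C β) γ ∧
      length γ = ENNReal.ofReal (2 * |β - α| / C) := by
  -- Distinct end angles in `[0, π]` keep the interior angles off the cusps, where the metric is
  -- singular.
  have hang : ∀ t ∈ Set.Ioo (0 : ℝ) 1, 0 < Real.sin (α + t * (β - α)) := fun t ht => by
    have h1 : α + t * (β - α) = (1 - t) * α + t * β := by ring
    have ht' : 0 < 1 - t := sub_pos.2 ht.2
    refine Real.sin_pos_of_pos_of_lt_pi ?_ ?_ <;> rcases hαβ.lt_or_gt with h | h <;>
      nlinarith [hα.1, hα.2, hβ.1, hβ.2, ht.1, mul_pos ht.1 (sub_pos.2 h),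
        mul_pos ht' (sub_pos.2 h)]
  have hder : ∀ t, HasDerivAt (fun t => cycloid x σ C (α + t * (β - α)))
      ((β - α) • (σ * (2 * Real.sin (α + t * (β - α)) ^ 2 / C ^ 2),
        2 * Real.sin (α + t * (β - α)) * Real.cos (α + t * (β - α)) / C ^ 2)) t := fun t => by
    have h : HasDerivAt (fun t => α + t * (β - α)) (β - α) t := by
      simpa using ((hasDerivAt_id t).mul_const (β - α)).const_add α
    exact (hasDerivAt_cycloid x σ C (α + t * (β - α))).scomp t h
  refine ⟨fun t => cycloid x σ C (α + t * (β - α)), ⟨by simp, by simp, ?_, ?_, fun t ht => ?_⟩, ?_⟩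
  · exact fun t _ => (hder t).continuousAt.continuousWithinAt
  · have : ContDiff ℝ 1 (fun t => cycloid x σ C (α + t * (β - α))) := by
      unfold cycloid
      fun_prop
    exact this.contDiffOn
  · have := hang t ht
    simp only [cycloid]
    positivity
  · rw [length, setLIntegral_congr_fun (g := fun _ => ENNReal.ofReal (2 * |β - α| / C))
      measurableSet_Ioo fun t ht => ?_]
    · simp
    · simp only
      rw [(hder t).deriv, tangentNorm_cycloid hσ hC (hang t ht).ne']

theorem dist_eq_of_forall_le {p q : ℝ × ℝ} {D : ℝ} (hD : 0 ≤ D)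
    (hle : ∀ γ, IsCurve p q γ → ENNReal.ofReal D ≤ length γ)
    (hex : ∃ γ, IsCurve p q γ ∧ length γ = ENNReal.ofReal D) : dist p q = D := by
  obtain ⟨γ, hγ, hlen⟩ := hex
  have : (⨅ (γ : ℝ → ℝ × ℝ) (_ : IsCurve p q γ), length γ) = ENNReal.ofReal D :=
    le_antisymm (hlen ▸ iInf₂_le γ hγ) (le_iInf₂ hle)
  rw [dist, this, ENNReal.toReal_ofReal hD]

theorem sin_arcsin_sq_div {C v : ℝ} (hC : 0 < C) (hv : 0 ≤ v) (h : C * √v ≤ 1) :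
    Real.sin (Real.arcsin (C * √v)) ^ 2 / C ^ 2 = v := by
  have h0 : 0 ≤ C * √v := by positivity
  rw [Real.sin_arcsin (by linarith) h, mul_pow, Real.sq_sqrt hv]
  field_simp

theorem arcsin_mem_Icc_zero_pi {u : ℝ} (h : 0 ≤ u) : Real.arcsin u ∈ Set.Icc 0 Real.pi :=
  ⟨Real.arcsin_nonneg.2 h, by linarith [Real.arcsin_le_pi_div_two u, Real.pi_pos]⟩

theorem dist_of_abs_sub_eq_Fbar_sub {x₀ v₀ x₁ v₁ C : ℝ} (h₀ : 0 ≤ v₀) (h₁ : 0 ≤ v₁)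
    (hx : x₀ ≠ x₁) (hC : 0 < C) (hC₀ : C * √v₀ ≤ 1) (hC₁ : C * √v₁ ≤ 1)
    (hd : |x₁ - x₀| = |Fbar v₁ C - Fbar v₀ C|) :
    dist (x₀, v₀) (x₁, v₁)
      = 2 * (|Real.arcsin (C * √v₁) - Real.arcsin (C * √v₀)| / C) := by
  have hu₀ : 0 ≤ C * √v₀ := by positivity
  have hu₁ : 0 ≤ C * √v₁ := by positivity
  have hd0 : 0 < |x₁ - x₀| := abs_pos.2 (sub_ne_zero.2 hx.symm)
  refine dist_eq_of_forall_le (by positivity) (fun γ hγ => ?_) ?_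
  · refine le_trans (ENNReal.ofReal_le_ofReal ?_)
      (hγ.le_length_of_le_arch h₀ h₁ hC hC₀ hC₁ ?_)
    · have hsum : C * (Fbar v₁ C - Fbar v₀ C) + (potential C v₁ - potential C v₀)
          = 2 * ((Real.arcsin (C * √v₁) - Real.arcsin (C * √v₀)) / C) := by
        have e0 := potential_add_mul_Fbar hC.ne' v₀
        have e1 := potential_add_mul_Fbar hC.ne' v₁
        linear_combination e1 - e0
      have hrw : 2 * (|Real.arcsin (C * √v₁) - Real.arcsin (C * √v₀)| / C)
          = |2 * ((Real.arcsin (C * √v₁) - Real.arcsin (C * √v₀)) / C)| := by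
        rw [abs_mul, abs_div, abs_of_pos hC, abs_two]
      dsimp only
      rw [hrw, ← hsum, hd]
      refine (abs_add_le _ _).trans_eq ?_
      rw [abs_mul, abs_of_pos hC]
    -- Since `Fbar ≤ π / (2C²)` at both heights, an arc before the apex is no wider than the arch
    -- through it.
    · have e0 := Fbar_le_pi_div hC v₀
      have e1 := Fbar_le_pi_div hC v₁
      have e2 : Real.pi / C ^ 2 = 2 * (Real.pi / 2 / C ^ 2) := by ring
      dsimp only
      rw [hd, arch, e2, abs_le]
      constructor <;> linarith
  · obtain ⟨σ, hσ, hσx⟩ : ∃ σ : ℝ, σ ^ 2 = 1 ∧ x₁ - x₀ = σ * (Fbar v₁ C - Fbar v₀ C) := by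
      rcases abs_eq_abs.1 hd with h | h
      · exact ⟨1, by norm_num, by rw [h, one_mul]⟩
      · exact ⟨-1, by norm_num, by rw [h, neg_one_mul]⟩
    have hne : Real.arcsin (C * √v₀) ≠ Real.arcsin (C * √v₁) := fun h => by
      rw [hd, Fbar_eq h₁ hC hC₁, Fbar_eq h₀ hC hC₀, h] at hd0
      simp at hd0
    obtain ⟨γ, hγ, hlen⟩ := exists_curve_cycloid (x := x₀ - σ * Fbar v₀ C) hσ hC
      (arcsin_mem_Icc_zero_pi hu₀) (arcsin_mem_Icc_zero_pi hu₁) hne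
    have hp : cycloid (x₀ - σ * Fbar v₀ C) σ C (Real.arcsin (C * √v₀)) = (x₀, v₀) := by
      rw [cycloid, sin_arcsin_sq_div hC h₀ hC₀, ← Fbar_eq h₀ hC hC₀, sub_add_cancel]
    have hq : cycloid (x₀ - σ * Fbar v₀ C) σ C (Real.arcsin (C * √v₁)) = (x₁, v₁) := by
      rw [cycloid, sin_arcsin_sq_div hC h₁ hC₁, ← Fbar_eq h₁ hC hC₁, Prod.mk.injEq]
      exact ⟨by linear_combination -hσx, rfl⟩
    rw [hp, hq] at hγ
    exact ⟨γ, hγ, by rw [hlen, mul_div_assoc]⟩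

theorem dist_of_abs_sub_eq_arch {x₀ v₀ x₁ v₁ C : ℝ} (h₀ : 0 ≤ v₀) (h₁ : 0 ≤ v₁)
    (hx : x₀ ≠ x₁) (hC : 0 < C) (hC₀ : C * √v₀ ≤ 1) (hC₁ : C * √v₁ ≤ 1)
    (hd : |x₁ - x₀| = arch v₀ v₁ C) :
    dist (x₀, v₀) (x₁, v₁)
      = 2 * ((Real.arccos (C * √v₀) + Real.arccos (C * √v₁)) / C) := by
  have hu₀ : 0 ≤ C * √v₀ := by positivity
  have hu₁ : 0 ≤ C * √v₁ := by positivity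
  have hd0 : 0 < |x₁ - x₀| := abs_pos.2 (sub_ne_zero.2 hx.symm)
  have hcos₀ := Real.arccos_nonneg (C * √v₀)
  have hcos₁ := Real.arccos_nonneg (C * √v₁)
  refine dist_eq_of_forall_le (by positivity) (fun γ hγ => ?_) ?_
  · refine le_trans (ENNReal.ofReal_le_ofReal (le_of_eq ?_))
      (hγ.le_length_of_eq_arch h₀ h₁ hC hC₀ hC₁ hd)
    have e0 := potential_add_mul_Fbar hC.ne' v₀
    have e1 := potential_add_mul_Fbar hC.ne' v₁
    have e2 : C * (Real.pi / C ^ 2) = Real.pi / C := by field_simp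
    dsimp only
    rw [hd, archPotential, arch, Real.arccos, Real.arccos]
    linear_combination e0 + e1 - e2
  · obtain ⟨σ, hσ, hσx⟩ := exists_sq_eq_one_mul_eq_abs (x₁ - x₀)
    have hF : arch v₀ v₁ C = (Real.pi - Real.arcsin (C * √v₁)
        - Real.sin (Real.pi - Real.arcsin (C * √v₁))
          * Real.cos (Real.pi - Real.arcsin (C * √v₁))) / C ^ 2 - Fbar v₀ C := by
      rw [arch, Fbar_eq h₁ hC hC₁, Real.sin_pi_sub, Real.cos_pi_sub]
      ring
    have hne : Real.arcsin (C * √v₀) ≠ Real.pi - Real.arcsin (C * √v₁) := fun h => by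
      rw [hd, hF, ← h, Fbar_eq h₀ hC hC₀, sub_self] at hd0
      exact lt_irrefl _ hd0
    have hmem := arcsin_mem_Icc_zero_pi hu₁
    obtain ⟨γ, hγ, hlen⟩ := exists_curve_cycloid (x := x₀ - σ * Fbar v₀ C)
      -- The angle `π - arcsin` is the point of height `v₁` on the descending side of the arch.
      (α := Real.arcsin (C * √v₀)) (β := Real.pi - Real.arcsin (C * √v₁)) hσ hC
      (arcsin_mem_Icc_zero_pi hu₀) ⟨by linarith [hmem.2], by linarith [hmem.1]⟩ hne
    have hp : cycloid (x₀ - σ * Fbar v₀ C) σ C (Real.arcsin (C * √v₀)) = (x₀, v₀) := by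
      rw [cycloid, sin_arcsin_sq_div hC h₀ hC₀, ← Fbar_eq h₀ hC hC₀, sub_add_cancel]
    have hq : cycloid (x₀ - σ * Fbar v₀ C) σ C (Real.pi - Real.arcsin (C * √v₁))
        = (x₁, v₁) := by
      have hend : (Real.pi - Real.arcsin (C * √v₁)
          - Real.sin (Real.pi - Real.arcsin (C * √v₁))
            * Real.cos (Real.pi - Real.arcsin (C * √v₁))) / C ^ 2
          = σ * (x₁ - x₀) + Fbar v₀ C := by
        rw [hσx, hd, hF]; ring
      rw [cycloid, hend, Real.sin_pi_sub, sin_arcsin_sq_div hC h₁ hC₁, Prod.mk.injEq]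
      exact ⟨by linear_combination (x₁ - x₀) * hσ, rfl⟩
    rw [hp, hq] at hγ
    refine ⟨γ, hγ, ?_⟩
    have : Real.pi - Real.arcsin (C * √v₁) - Real.arcsin (C * √v₀)
        = Real.arccos (C * √v₀) + Real.arccos (C * √v₁) := by
      rw [Real.arccos, Real.arccos]; ring
    rw [hlen, mul_div_assoc, this, abs_of_nonneg (by positivity)]

/-! ### The threshold and the two regimes. -/

theorem close_rhs_eq (v₀ v₁ C : ℝ) :
    √v₀ * √(1 - C ^ 2 * v₀) / C - Real.arcsin (C * √v₀) / C ^ 2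
        - (√v₁ * √(1 - C ^ 2 * v₁) / C - Real.arcsin (C * √v₁) / C ^ 2)
      = Fbar v₁ C - Fbar v₀ C := by
  simp only [Fbar]
  ring

theorem threshold_comm (v₀ v₁ : ℝ) : threshold v₀ v₁ = threshold v₁ v₀ := by
  rw [threshold, threshold, min_comm, max_comm]

theorem threshold_of_lt {v w : ℝ} (hv : 0 ≤ v) (hvw : v < w) :
    threshold v w = Fbar w (1 / √w) - Fbar v (1 / √w) := by
  have := Real.sqrt_pos.2 (hv.trans_lt hvw)
  rw [threshold, max_eq_right hvw.le, min_eq_left hvw.le, F, if_neg (by positivity)]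

theorem threshold_self (v : ℝ) : threshold v v = 0 := by simp [threshold, F]

theorem arch_comm (v₀ v₁ C : ℝ) : arch v₀ v₁ C = arch v₁ v₀ C := by simp only [arch]; ring

/-- Here `w` is the height of the apex, and the value is half the width of a full arch. Hence `arch`
equals the threshold at this parameter, and the two regimes meet there. -/
theorem Fbar_one_div_sqrt {w : ℝ} (hw : 0 < w) :
    Fbar w (1 / √w) = Real.pi / 2 / (1 / √w) ^ 2 := by
  have := Real.sqrt_pos.2 hw
  have h1 : 1 / √w * √w = 1 := by field_simp
  have h2 : (1 / √w) ^ 2 * w = 1 := by rw [div_pow, Real.sq_sqrt hw.le]; field_simp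
  rw [Fbar, h1, h2]
  simp

/-- The quotient is even in `C`, so the sign of `C`, which only records the direction of travel,
drops out of the distance. -/
theorem abs_arcsin_mul_div {C r s : ℝ} (hC : C ≠ 0) (hr : r ≤ s) :
    |Real.arcsin (|C| * s) - Real.arcsin (|C| * r)| / |C|
      = (Real.arcsin (C * s) - Real.arcsin (C * r)) / C := by
  have h := Real.monotone_arcsin (mul_le_mul_of_nonneg_left hr (abs_nonneg C))
  rw [abs_of_nonneg (sub_nonneg.2 h)]
  rcases hC.lt_or_gt with h | h
  · simp only [abs_of_neg h, neg_mul, Real.arcsin_neg]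
    field_simp
    ring
  · rw [abs_of_pos h]

theorem mul_sqrt_le_one_of_le {C v w : ℝ} (hC : 0 ≤ C) (hvw : v ≤ w) (h : C * √w ≤ 1) :
    C * √v ≤ 1 :=
  (mul_le_mul_of_nonneg_left (Real.sqrt_le_sqrt hvw) hC).trans h

/-- The close regime. -/
theorem close_regime {x₀ v₀ x₁ v₁ : ℝ} (h₀ : 0 ≤ v₀) (h₁ : 0 ≤ v₁) (hx : x₀ ≠ x₁)
    (h : |x₁ - x₀| ≤ threshold v₀ v₁) :
    ∃ C : ℝ, C ≠ 0 ∧ IsCloseSolution x₀ v₀ x₁ v₁ C ∧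
      (∀ C' : ℝ, IsCloseSolution x₀ v₀ x₁ v₁ C' → C' = C) ∧
      dist (x₀, v₀) (x₁, v₁) =
        2 * ((Real.arcsin (C * √(max v₀ v₁)) - Real.arcsin (C * √(min v₀ v₁))) / C) := by
  have hd0 : 0 < |x₁ - x₀| := abs_pos.2 (sub_ne_zero.2 hx.symm)
  simp only [IsCloseSolution, close_rhs_eq]
  rcases lt_trichotomy v₀ v₁ with hlt | rfl | hlt
  · rw [threshold_of_lt h₀ hlt] at h
    obtain ⟨C, hC, hC₁, hF, habs, huniq⟩ :=
      exists_unique_Fbar_sub_eq h₀ hlt (sub_ne_zero.2 hx.symm) h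
    have hC₀ := mul_sqrt_le_one_of_le (abs_nonneg C) hlt.le hC₁
    refine ⟨C, hC, ⟨⟨hC₀, hC₁⟩, hF.symm⟩, fun C' h' => huniq C' h'.1.2 h'.2.symm, ?_⟩
    rw [dist_of_abs_sub_eq_Fbar_sub h₀ h₁ hx (abs_pos.2 hC) hC₀ hC₁ (by rw [habs, abs_abs]),
      abs_arcsin_mul_div hC (Real.sqrt_le_sqrt hlt.le), max_eq_right hlt.le, min_eq_left hlt.le]
  · rw [threshold_self] at h
    exact absurd h hd0.not_ge
  · rw [threshold_comm, threshold_of_lt h₁ hlt, abs_sub_comm] at h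
    obtain ⟨C, hC, hC₀, hF, habs, huniq⟩ :=
      exists_unique_Fbar_sub_eq h₁ hlt (sub_ne_zero.2 hx) h
    have hC₁ := mul_sqrt_le_one_of_le (abs_nonneg C) hlt.le hC₀
    refine ⟨C, hC, ⟨⟨hC₀, hC₁⟩, by linarith⟩,
      fun C' h' => huniq C' h'.1.1 (by linarith [h'.2]), ?_⟩
    rw [dist_of_abs_sub_eq_Fbar_sub h₀ h₁ hx (abs_pos.2 hC) hC₀ hC₁
        (by rw [abs_sub_comm (Fbar _ _), habs, abs_abs, abs_sub_comm]),
      abs_sub_comm, abs_arcsin_mul_div hC (Real.sqrt_le_sqrt hlt.le), max_eq_left hlt.le,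
      min_eq_right hlt.le]

theorem exists_arch_eq_of_le {v w d : ℝ} (hv : 0 ≤ v) (hvw : v ≤ w) (hd : 0 < d)
    (h : threshold v w ≤ d) :
    ∃ C : ℝ, 0 < C ∧ C * √v ≤ 1 ∧ C * √w ≤ 1 ∧ d = arch v w C := by
  obtain ⟨m, hm, hmw, hmd⟩ : ∃ m : ℝ, 0 < m ∧ m * √w ≤ 1 ∧ arch v w m ≤ d := by
    rcases (hv.trans hvw).eq_or_lt with rfl | hw
    · obtain rfl : v = 0 := le_antisymm hvw hv
      -- With both heights zero the parameter is unbounded and `arch` is `π / C²`; this choice gives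
      -- exactly `d`.
      refine ⟨√(Real.pi / d), Real.sqrt_pos.2 (by positivity), by simp, le_of_eq ?_⟩
      simp only [arch, Fbar, Real.sqrt_zero, mul_zero, Real.arcsin_zero, zero_div, zero_mul,
        sub_zero]
      rw [Real.sq_sqrt (by positivity)]
      field_simp
    · have hr := Real.sqrt_pos.2 hw
      refine ⟨1 / √w, by positivity, by field_simp; rfl, le_trans (le_of_eq ?_) h⟩
      have e := Fbar_one_div_sqrt hw
      rcases hvw.eq_or_lt with rfl | hlt
      · rw [threshold_self, arch, e]
        ring
      · rw [threshold_of_lt hv hlt, arch, e]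
        ring
  obtain ⟨ε, hε, hεm, hεd⟩ := exists_arch_ge (v₀ := v) (v₁ := w) hm hd
  obtain ⟨C, hC, hCd⟩ := intermediate_value_Icc' hεm
    ((continuousOn_arch v w).mono fun K hK => hε.trans_le hK.1) ⟨hmd, hεd⟩
  have hC0 := hε.trans_le hC.1
  have hCw : C * √w ≤ 1 := le_trans (mul_le_mul_of_nonneg_right hC.2 (Real.sqrt_nonneg w)) hmw
  exact ⟨C, hC0, mul_sqrt_le_one_of_le hC0.le hvw hCw, hCw, hCd.symm⟩

theorem exists_arch_eq {v₀ v₁ d : ℝ} (h₀ : 0 ≤ v₀) (h₁ : 0 ≤ v₁) (hd : 0 < d)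
    (h : threshold v₀ v₁ ≤ d) :
    ∃ C : ℝ, 0 < C ∧ C * √v₀ ≤ 1 ∧ C * √v₁ ≤ 1 ∧ d = arch v₀ v₁ C := by
  rcases le_total v₀ v₁ with hle | hle
  · exact exists_arch_eq_of_le h₀ hle hd h
  · obtain ⟨C, hC, hC₁, hC₀, hCd⟩ := exists_arch_eq_of_le h₁ hle hd (by rwa [threshold_comm])
    exact ⟨C, hC, hC₀, hC₁, by rw [hCd, arch_comm]⟩

/-- The far regime. -/
theorem far_regime {x₀ v₀ x₁ v₁ : ℝ} (h₀ : 0 ≤ v₀) (h₁ : 0 ≤ v₁) (hx : x₀ ≠ x₁)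
    (h : threshold v₀ v₁ ≤ |x₁ - x₀|) :
    ∃ C : ℝ, IsFarSolution x₀ v₀ x₁ v₁ C ∧
      (∀ C' : ℝ, IsFarSolution x₀ v₀ x₁ v₁ C' → C' = C) ∧
      dist (x₀, v₀) (x₁, v₁) =
        2 * ((Real.arccos (C * √v₀) + Real.arccos (C * √v₁)) / C) := by
  have hd0 : 0 < |x₁ - x₀| := abs_pos.2 (sub_ne_zero.2 hx.symm)
  simp only [IsFarSolution, ← arch_eq]
  obtain ⟨C, hC, hC₀, hC₁, hCd⟩ := exists_arch_eq h₀ h₁ hd0 h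
  refine ⟨C, ⟨⟨hC, by rwa [abs_of_pos hC], by rwa [abs_of_pos hC]⟩, hCd⟩, ?_,
    dist_of_abs_sub_eq_arch h₀ h₁ hx hC hC₀ hC₁ hCd⟩
  rintro C' ⟨⟨hC', hC'₀, hC'₁⟩, hC'd⟩
  rw [abs_of_pos hC'] at hC'₀ hC'₁
  have e := hC'd.symm.trans hCd
  -- The larger of the two solutions serves as the upper end of the interval of strict monotonicity.
  rcases le_total C' C with hle | hle
  · exact (strictAntiOn_arch h₀ h₁ hC₀ hC₁).injOn ⟨hC', hle⟩ ⟨hC, le_rfl⟩ e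
  · exact (strictAntiOn_arch h₀ h₁ hC'₀ hC'₁).injOn ⟨hC', le_rfl⟩ ⟨hC, hle⟩ e

end Heston

theorem theorem2p1 (x₀ v₀ x₁ v₁ : ℝ)
    (h₀ : (x₀, v₀) ∈ Heston.halfPlane) (h₁ : (x₁, v₁) ∈ Heston.halfPlane) (hx : x₀ ≠ x₁) :
    (|x₁ - x₀| ≤ Heston.threshold v₀ v₁ →
      ∃ C : ℝ, C ≠ 0 ∧ Heston.IsCloseSolution x₀ v₀ x₁ v₁ C ∧
        (∀ C' : ℝ, Heston.IsCloseSolution x₀ v₀ x₁ v₁ C' → C' = C) ∧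
        Heston.dist (x₀, v₀) (x₁, v₁) =
          2 * ((Real.arcsin (C * √(max v₀ v₁)) - Real.arcsin (C * √(min v₀ v₁))) / C)) ∧
    (Heston.threshold v₀ v₁ ≤ |x₁ - x₀| →
      ∃ C : ℝ, Heston.IsFarSolution x₀ v₀ x₁ v₁ C ∧
        (∀ C' : ℝ, Heston.IsFarSolution x₀ v₀ x₁ v₁ C' → C' = C) ∧
        Heston.dist (x₀, v₀) (x₁, v₁) =
          2 * ((Real.arccos (C * √v₀) + Real.arccos (C * √v₁)) / C)) := by
  exact ⟨Heston.close_regime h₀ h₁ hx, Heston.far_regime h₀ h₁ hx⟩
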